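/- Let $\mathbf S^n$ be the space of real symmetric $n\times n$ matrices with inner product $\langle X,Y\rangle=\operatorname{tr}(XY)$, and let $\lambda\colon\mathbf S^n\to\mathbb R^n$ map a matrix to the vector of its eigenvalues (with multiplicity) in nonincreasing order. For $X\in\mathbf S^n$ let $\mathbf O^n_X$ be the set of orthogonal matrices $U$ with $X=U^T(\operatorname{Diag}\lambda(X))U$. A function $f\colon\mathbb R^n\to\mathbb R\cup\{\pm\infty\}$ is locally symmetric at $\bar x$ if $f(x)=f(\sigma x)$ for all $x$ near $\bar x$ and all coordinate permutations $\sigma$ with $\sigma\bar x=\bar x$. For an extended-real-valued function $g$ on a Euclidean space $\mathbf E$, the Fréchet subdifferential $\hat\partial g(\bar x)$ at a point $\bar x$ with $g(\bar x)$ finite is the (convex) set of all $v\in\mathbf E$ with $g(x)\ge g(\bar x)+\langle v,x-\bar x\rangle+o(\|x-\bar x\|)$ as $x\to\bar x$; it is empty if $g(\bar x)$ is infinite. Write $\operatorname{aff}$, $\operatorname{rb}$ and $\operatorname{ri}$ for the affine span, the relative boundary and the relative interior (the affine span of the empty set being empty). Let $f\colon\mathbb R^n\to\mathbb R\cup\{\pm\infty\}$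 be a function and let $X\in\mathbf S^n$, and suppose that $f$ is locally symmetric at $\lambda(X)$. Then $$\operatorname{aff}\hat\partial(f\circ\lambda)(X)=\{U^T(\operatorname{Diag}v)U: v\in\operatorname{aff}\hat\partial f(\lambda(X)),\ U\in\mathbf O^n_X\},$$ $$\operatorname{rb}\hat\partial(f\circ\lambda)(X)=\{U^T(\operatorname{Diag}v)U: v\in\operatorname{rb}\hat\partial f(\lambda(X)),\ U\in\mathbf O^n_X\},$$ $$\operatorname{ri}\hat\partial(f\circ\lambda)(X)=\{U^T(\operatorname{Diag}v)U: v\in\operatorname{ri}\hat\partial f(\lambda(X)),\ U\in\mathbf O^n_X\}.$$ -/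

import Mathlib

open scoped Matrix Topology InnerProductSpace

noncomputable section

namespace SpectralSub

/-! ### The Euclidean space of real symmetric matrices -/

/-- The real `n × n` symmetric matrices, as a linear subspace of the matrix space. -/
def symSubmodule (n : ℕ) : Submodule ℝ (Matrix (Fin n) (Fin n) ℝ) where
  carrier := {A | A.IsSymm}
  add_mem' := fun ha hb => Matrix.IsSymm.add ha hb
  zero_mem' := Matrix.isSymm_zero
  smul_mem' := fun c _ ha => Matrix.IsSymm.smul ha c

/-- The space `𝐒ⁿ` of real `n × n` symmetric matrices. It is a type of its own, so that its only
norm and topology are those of the trace inner product. -/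
def SymMat (n : ℕ) : Type := symSubmodule n

instance (n : ℕ) : AddCommGroup (SymMat n) := inferInstanceAs (AddCommGroup (symSubmodule n))

instance (n : ℕ) : Module ℝ (SymMat n) := inferInstanceAs (Module ℝ (symSubmodule n))

/-- The underlying matrix of an element of `𝐒ⁿ`. -/
def SymMat.toMatrix {n : ℕ} (X : SymMat n) : Matrix (Fin n) (Fin n) ℝ := X.1

theorem SymMat.isSymm {n : ℕ} (X : SymMat n) : X.toMatrix.IsSymm := X.2

theorem SymMat.isHermitian {n : ℕ} (X : SymMat n) : X.toMatrix.IsHermitian := by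
  rw [Matrix.IsHermitian, Matrix.conjTranspose_eq_transpose_of_trivial]
  exact X.isSymm

/-- The trace inner product `⟨X, Y⟩ = tr (X Y)` on `𝐒ⁿ`. -/
@[reducible] def symCore (n : ℕ) : InnerProductSpace.Core ℝ (SymMat n) where
  inner X Y := (X.toMatrix * Y.toMatrix).trace
  conj_inner_symm X Y := by
    simp only [conj_trivial]
    exact Matrix.trace_mul_comm _ _
  re_inner_nonneg X := by
    have h := Matrix.PosSemidef.trace_nonneg (Matrix.posSemidef_conjTranspose_mul_self X.toMatrix)
    rw [X.isHermitian.eq] at h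
    simpa using h
  add_left X Y Z := by
    change ((X.toMatrix + Y.toMatrix) * Z.toMatrix).trace = _
    rw [Matrix.add_mul, Matrix.trace_add]
  smul_left X Y r := by
    change ((r • X.toMatrix) * Y.toMatrix).trace = _
    rw [Matrix.smul_mul, Matrix.trace_smul]
    simp
  definite X h := by
    have h' : (X.toMatrixᴴ * X.toMatrix).trace = 0 := by
      rw [X.isHermitian.eq]
      exact h
    exact Subtype.ext (Matrix.trace_conjTranspose_mul_self_eq_zero_iff.mp h')

instance (n : ℕ) : NormedAddCommGroup (SymMat n) :=
  @InnerProductSpace.Core.toNormedAddCommGroup ℝ (SymMat n) _ _ _ (symCore n)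

instance (n : ℕ) : InnerProductSpace ℝ (SymMat n) := InnerProductSpace.ofCore (symCore n).toCore

theorem SymMat.inner_eq_trace {n : ℕ} (X Y : SymMat n) :
    ⟪X, Y⟫_ℝ = (X.toMatrix * Y.toMatrix).trace := rfl

/-! ### The spectral mapping, orthogonal conjugation, local symmetry -/

/-- The spectral mapping `λ : 𝐒ⁿ → ℝⁿ`: the eigenvalues, with multiplicity, in nonincreasing
order (see `antitone_spec`). -/
def spec {n : ℕ} (X : SymMat n) : EuclideanSpace ℝ (Fin n) :=
  WithLp.toLp 2 fun i => X.isHermitian.eigenvalues₀ (Fin.cast (Fintype.card_fin n).symm i)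

theorem antitone_spec {n : ℕ} (X : SymMat n) : Antitone fun i => spec X i :=
  fun _ _ hij => X.isHermitian.eigenvalues₀_antitone hij

/-- The symmetric matrix `Uᵀ (Diag v) U`. -/
def conjDiag {n : ℕ} (U : Matrix (Fin n) (Fin n) ℝ) (v : EuclideanSpace ℝ (Fin n)) : SymMat n :=
  ⟨Uᵀ * Matrix.diagonal (fun i => v i) * U, by
    change (Uᵀ * Matrix.diagonal (fun i => v i) * U)ᵀ = _
    simp [Matrix.transpose_mul, Matrix.mul_assoc]⟩

/-- The set `𝐎ⁿ_X` of orthogonal matrices `U` with `X = Uᵀ (Diag λ(X)) U`. -/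
def orthDiag {n : ℕ} (X : SymMat n) : Set (Matrix (Fin n) (Fin n) ℝ) :=
  {U | U ∈ Matrix.orthogonalGroup (Fin n) ℝ ∧ X = conjDiag U (spec X)}

/-- The action of a permutation on the coordinates of a vector. -/
def permute {n : ℕ} (σ : Equiv.Perm (Fin n)) (x : EuclideanSpace ℝ (Fin n)) :
    EuclideanSpace ℝ (Fin n) :=
  WithLp.toLp 2 fun i => x (σ.symm i)

/-- `f` is locally symmetric at `x₀`: `f x = f (σ x)` for all `x` near `x₀` and all permutations
`σ` that fix `x₀`. -/
def LocallySymmetricAt {n : ℕ} (f : EuclideanSpace ℝ (Fin n) → EReal)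
    (x₀ : EuclideanSpace ℝ (Fin n)) : Prop :=
  ∀ᶠ x in 𝓝 x₀, ∀ σ : Equiv.Perm (Fin n), permute σ x₀ = x₀ → f x = f (permute σ x)

/-! ### The Fréchet subdifferential -/

/-- The Fréchet subdifferential of `f` at `x₀`: all `v` such that
`f x ≥ f x₀ + ⟪v, x - x₀⟫ + o(‖x - x₀‖)` as `x → x₀`. By the usual convention it is empty when
`f x₀` is not finite. -/
def frechetSubdiff {E : Type*} [NormedAddCommGroup E] [InnerProductSpace ℝ E]
    (f : E → EReal) (x₀ : E) : Set E :=
  {v | f x₀ ≠ ⊥ ∧ f x₀ ≠ ⊤ ∧ ∀ ε : ℝ, 0 < ε → ∀ᶠ x in 𝓝 x₀,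
    f x₀ + ((⟪v, x - x₀⟫_ℝ - ε * ‖x - x₀‖ : ℝ) : EReal) ≤ f x}

end SpectralSub

end

/-!
Write `lift C` for the set of all `Uᵀ (Diag v) U` with `v ∈ C` and `U ∈ 𝐎ⁿ_X` (`spectralLift`). The
proof has two independent halves.

**The subdifferential of `f ∘ λ` at `X` is the lift of the subdifferential of `f` at `λ(X)`**
(`frechetSubdiff_comp_spec`). A subgradient `V` of `f ∘ λ` commutes with `X`, because `f ∘ λ` is
constant along the orbit `t ↦ exp(tA)ᵀ X exp(tA)` for every skew-symmetric `A`; taking for `A` the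
commutator of `X` and `V` gives `‖A‖² ≤ 0`. Hence `V = Uᵀ (Diag v) U` with `U ∈ 𝐎ⁿ_X`, and
restricting the subgradient inequality to the matrices `Uᵀ (Diag x) U` shows that `v` is a
subgradient of `f`.
Conversely, Fan's inequality `⟨A, Y⟩ ≤ ⟨λ(A), λ(Y)⟩` for `A = X + t Uᵀ (Diag v) U` with one fixed
small `t > 0`, where `λ(A) = λ(X) + t w` and `w` arises from `v` by a permutation fixing `λ(X)`,
yields
`⟨Uᵀ (Diag v) U, Y - X⟩ ≤ ⟨w, λ(Y) - λ(X)⟩ + ‖Y - X‖² / (2t)`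
(`exists_inner_le_inner_spec_sub`). As `w` is a subgradient of `f` by local symmetry and `λ` is
`1`-Lipschitz, `Uᵀ (Diag v) U` is a subgradient of `f ∘ λ`.

**For convex `C` invariant under the permutations fixing `λ(X)`, the lift commutes with affine span,
closure and relative interior**, hence with relative boundary. The tool is a local form of Schur's
theorem (`diagPart_conjDiag_mem`), a consequence of Birkhoff's theorem: if `Y ∈ lift C` and
`V ∈ 𝐎ⁿ_X`, then the diagonal of `V Y Vᵀ` is in `C`. So a matrix `Uᵀ (Diag v) U` lies in
`lift C` only if `v ∈ C`, and `Y ↦ diag (U Y Uᵀ)` and `v ↦ Uᵀ (Diag v) U` are linear maps that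
carry affine spans and closures back and forth. For relative interiors, compactness of `𝐎ⁿ_X` makes the
neighbourhoods uniform in `U`.
-/

noncomputable section

namespace SpectralSub

variable {n : ℕ}

/-! ### Conjugated diagonal matrices -/

theorem toMatrix_conjDiag (U : Matrix (Fin n) (Fin n) ℝ) (v : EuclideanSpace ℝ (Fin n)) :
    (conjDiag U v).toMatrix = Uᵀ * Matrix.diagonal (fun i => v i) * U := rfl

theorem SymMat.ext {X Y : SymMat n} (h : X.toMatrix = Y.toMatrix) : X = Y := Subtype.ext h

theorem SymMat.toMatrix_add (X Y : SymMat n) : (X + Y).toMatrix = X.toMatrix + Y.toMatrix := rfl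

theorem SymMat.toMatrix_smul (c : ℝ) (X : SymMat n) : (c • X).toMatrix = c • X.toMatrix := rfl

instance (n : ℕ) : FiniteDimensional ℝ (SymMat n) :=
  inferInstanceAs (FiniteDimensional ℝ (symSubmodule n))

/-- The inclusion of `𝐒ⁿ` into the space of matrices, as a linear map. -/
def toMatrixₗ (n : ℕ) : SymMat n →ₗ[ℝ] Matrix (Fin n) (Fin n) ℝ where
  toFun := SymMat.toMatrix
  map_add' _ _ := rfl
  map_smul' _ _ := rfl

theorem continuous_toMatrix : Continuous (SymMat.toMatrix : SymMat n → _) :=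
  (toMatrixₗ n).continuous_of_finiteDimensional

/-- The linear map `v ↦ Uᵀ (Diag v) U`. -/
def conjDiagₗ (U : Matrix (Fin n) (Fin n) ℝ) : EuclideanSpace ℝ (Fin n) →ₗ[ℝ] SymMat n where
  toFun := conjDiag U
  map_add' x y := SymMat.ext <| by
    rw [SymMat.toMatrix_add]
    simp only [toMatrix_conjDiag, PiLp.add_apply, ← Matrix.diagonal_add, Matrix.mul_add,
      Matrix.add_mul]
  map_smul' c x := SymMat.ext <| by
    rw [SymMat.toMatrix_smul]
    have h : (Matrix.diagonal fun i => (c • x) i) = c • Matrix.diagonal fun i => x i := by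
      ext i j
      by_cases h : i = j <;> simp [h]
    simp only [toMatrix_conjDiag, h, Matrix.mul_smul, Matrix.smul_mul, RingHom.id_apply]

theorem conjDiag_add (U : Matrix (Fin n) (Fin n) ℝ) (v w : EuclideanSpace ℝ (Fin n)) :
    conjDiag U (v + w) = conjDiag U v + conjDiag U w := (conjDiagₗ U).map_add v w

theorem conjDiag_sub (U : Matrix (Fin n) (Fin n) ℝ) (v w : EuclideanSpace ℝ (Fin n)) :
    conjDiag U (v - w) = conjDiag U v - conjDiag U w := (conjDiagₗ U).map_sub v w

theorem conjDiag_smul (U : Matrix (Fin n) (Fin n) ℝ) (c : ℝ) (v : EuclideanSpace ℝ (Fin n)) :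
    conjDiag U (c • v) = c • conjDiag U v := (conjDiagₗ U).map_smul c v

theorem continuous_conjDiag (U : Matrix (Fin n) (Fin n) ℝ) :
    Continuous (conjDiag U) := (conjDiagₗ U).continuous_of_finiteDimensional

theorem transpose_mul_self_of_orthogonal {U : Matrix (Fin n) (Fin n) ℝ}
    (hU : U ∈ Matrix.orthogonalGroup (Fin n) ℝ) : Uᵀ * U = 1 := 
  (Matrix.mem_orthogonalGroup_iff' _ _).1 hU

theorem mul_transpose_self_of_orthogonal {U : Matrix (Fin n) (Fin n) ℝ}
    (hU : U ∈ Matrix.orthogonalGroup (Fin n) ℝ) : U * Uᵀ = 1 := 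
  (Matrix.mem_orthogonalGroup_iff _ _).1 hU

theorem mem_orthogonalGroup_of_mul_transpose {U : Matrix (Fin n) (Fin n) ℝ}
    (hU : U * Uᵀ = 1) : U ∈ Matrix.orthogonalGroup (Fin n) ℝ :=
  (Matrix.mem_orthogonalGroup_iff _ _).2 hU

/-- The diagonal of `U Y Uᵀ`, as a vector. -/
def diagPart (U : Matrix (Fin n) (Fin n) ℝ) (Y : SymMat n) : EuclideanSpace ℝ (Fin n) :=
  WithLp.toLp 2 fun i => (U * Y.toMatrix * Uᵀ) i i

/-- `diagPart U` as a linear map. -/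
def diagPartₗ (U : Matrix (Fin n) (Fin n) ℝ) : SymMat n →ₗ[ℝ] EuclideanSpace ℝ (Fin n) where
  toFun := diagPart U
  map_add' X Y := by
    ext i
    simp [diagPart, SymMat.toMatrix_add, Matrix.mul_add, Matrix.add_mul]
  map_smul' c X := by
    ext i
    simp [diagPart, SymMat.toMatrix_smul]

@[simp]
theorem diagPartₗ_apply (U : Matrix (Fin n) (Fin n) ℝ) (Y : SymMat n) :
    diagPartₗ U Y = diagPart U Y := rfl

theorem continuous_uncurry_diagPart :
    Continuous fun p : SymMat n × Matrix (Fin n) (Fin n) ℝ => diagPart p.2 p.1 := by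
  refine (PiLp.continuous_toLp 2 _).comp (continuous_pi fun i => ?_)
  have h : Continuous fun p : SymMat n × Matrix (Fin n) (Fin n) ℝ =>
      p.2 * p.1.toMatrix * p.2ᵀ :=
    (continuous_snd.matrix_mul (continuous_toMatrix.comp continuous_fst)).matrix_mul
      continuous_snd.matrix_transpose
  exact h.matrix_elem i i

theorem diagPart_conjDiag_self {U : Matrix (Fin n) (Fin n) ℝ}
    (hU : U ∈ Matrix.orthogonalGroup (Fin n) ℝ) (v : EuclideanSpace ℝ (Fin n)) :
    diagPart U (conjDiag U v) = v := by
  ext i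
  have h : U * (Uᵀ * Matrix.diagonal (fun i => v i) * U) * Uᵀ =
      (U * Uᵀ) * Matrix.diagonal (fun i => v i) * (U * Uᵀ) := by
    simp only [Matrix.mul_assoc]
  simp [diagPart, toMatrix_conjDiag, h, mul_transpose_self_of_orthogonal hU]

theorem inner_conjDiag_left (U : Matrix (Fin n) (Fin n) ℝ) (v : EuclideanSpace ℝ (Fin n))
    (Y : SymMat n) : ⟪conjDiag U v, Y⟫_ℝ = ⟪v, diagPart U Y⟫_ℝ := by
  have h : (Uᵀ * Matrix.diagonal (fun i => v i) * U * Y.toMatrix).trace =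
      (Matrix.diagonal (fun i => v i) * (U * Y.toMatrix * Uᵀ)).trace := by
    rw [Matrix.mul_assoc, Matrix.mul_assoc, Matrix.trace_mul_comm]
    simp only [Matrix.mul_assoc]
  rw [SymMat.inner_eq_trace, toMatrix_conjDiag, h, PiLp.inner_apply, Matrix.trace]
  simp [diagPart, mul_comm, Matrix.diagonal_mul]

theorem inner_conjDiag_conjDiag {U : Matrix (Fin n) (Fin n) ℝ}
    (hU : U ∈ Matrix.orthogonalGroup (Fin n) ℝ) (v w : EuclideanSpace ℝ (Fin n)) :
    ⟪conjDiag U v, conjDiag U w⟫_ℝ = ⟪v, w⟫_ℝ := by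
  rw [inner_conjDiag_left, diagPart_conjDiag_self hU]

theorem norm_conjDiag {U : Matrix (Fin n) (Fin n) ℝ}
    (hU : U ∈ Matrix.orthogonalGroup (Fin n) ℝ) (v : EuclideanSpace ℝ (Fin n)) :
    ‖conjDiag U v‖ = ‖v‖ := by
  rw [@norm_eq_sqrt_real_inner _ _ _ (conjDiag U v), inner_conjDiag_conjDiag hU,
    norm_eq_sqrt_real_inner]

/-! ### Permutations and the ordered spectrum -/

@[simp]
theorem permute_apply (σ : Equiv.Perm (Fin n)) (x : EuclideanSpace ℝ (Fin n)) (i : Fin n) :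
    permute σ x i = x (σ.symm i) := rfl

/-- The coordinate permutation `permute σ` as a linear isometry. -/
def permuteₗᵢ (σ : Equiv.Perm (Fin n)) :
    EuclideanSpace ℝ (Fin n) ≃ₗᵢ[ℝ] EuclideanSpace ℝ (Fin n) :=
  LinearIsometryEquiv.piLpCongrLeft 2 ℝ ℝ σ

@[simp]
theorem permuteₗᵢ_apply (σ : Equiv.Perm (Fin n)) (x : EuclideanSpace ℝ (Fin n)) :
    permuteₗᵢ σ x = permute σ x := by
  ext i
  simp [permuteₗᵢ, LinearIsometryEquiv.piLpCongrLeft_apply]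

theorem permute_symm_permute (σ : Equiv.Perm (Fin n)) (x : EuclideanSpace ℝ (Fin n)) :
    permute σ.symm (permute σ x) = x := by
  ext i
  simp

theorem permute_permute_symm (σ : Equiv.Perm (Fin n)) (x : EuclideanSpace ℝ (Fin n)) :
    permute σ (permute σ.symm x) = x := by
  ext i
  simp

theorem permute_symm_eq_self {σ : Equiv.Perm (Fin n)} {x : EuclideanSpace ℝ (Fin n)}
    (h : permute σ x = x) : permute σ.symm x = x := by
  conv_lhs => rw [← h, permute_symm_permute]

theorem continuous_permute (σ : Equiv.Perm (Fin n)) : Continuous (permute σ) := by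
  have h : permute σ = permuteₗᵢ σ := funext fun x => (permuteₗᵢ_apply σ x).symm
  rw [h]
  exact (permuteₗᵢ σ).continuous

theorem inner_permute_permute (σ : Equiv.Perm (Fin n)) (x y : EuclideanSpace ℝ (Fin n)) :
    ⟪permute σ x, permute σ y⟫_ℝ = ⟪x, y⟫_ℝ := by
  simpa only [permuteₗᵢ_apply] using (permuteₗᵢ σ).inner_map_map x y

theorem permute_sub (σ : Equiv.Perm (Fin n)) (x y : EuclideanSpace ℝ (Fin n)) :
    permute σ (x - y) = permute σ x - permute σ y := by
  simpa only [permuteₗᵢ_apply] using (permuteₗᵢ σ).map_sub x y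

theorem norm_permute (σ : Equiv.Perm (Fin n)) (x : EuclideanSpace ℝ (Fin n)) :
    ‖permute σ x‖ = ‖x‖ := by
  simpa only [permuteₗᵢ_apply] using (permuteₗᵢ σ).norm_map x

theorem exists_antitone_permute (x : EuclideanSpace ℝ (Fin n)) :
    ∃ σ : Equiv.Perm (Fin n), Antitone fun i => permute σ x i := by
  refine ⟨(Tuple.sort fun i => -x i).symm, fun i j hij => ?_⟩
  have := Tuple.monotone_sort (fun i => -x i) hij
  simpa using this

/-- Reordering the rows of `U` compensates a permutation of the eigenvalues. -/
theorem conjDiag_submatrix (U : Matrix (Fin n) (Fin n) ℝ) (σ : Equiv.Perm (Fin n))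
    (x : EuclideanSpace ℝ (Fin n)) :
    conjDiag (U.submatrix σ.symm id) (permute σ x) = conjDiag U x := by
  refine SymMat.ext ?_
  ext a b
  rw [toMatrix_conjDiag, toMatrix_conjDiag, Matrix.mul_apply, Matrix.mul_apply]
  simp only [Matrix.mul_diagonal, Matrix.transpose_apply, Matrix.submatrix_apply, id,
    permute_apply]
  exact Equiv.sum_comp σ.symm fun i => U i a * x i * U i b

theorem submatrix_mem_orthogonalGroup {U : Matrix (Fin n) (Fin n) ℝ}
    (hU : U ∈ Matrix.orthogonalGroup (Fin n) ℝ) (σ : Equiv.Perm (Fin n)) :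
    U.submatrix σ.symm id ∈ Matrix.orthogonalGroup (Fin n) ℝ := by
  refine mem_orthogonalGroup_of_mul_transpose ?_
  rw [Matrix.transpose_submatrix, ← Matrix.submatrix_mul _ _ _ _ _ Function.bijective_id,
    mul_transpose_self_of_orthogonal hU, Matrix.submatrix_one_equiv]

/-- An ordered vector is its own vector of eigenvalues: both are ordered enumerations of the roots
of the characteristic polynomial. -/
theorem spec_conjDiag_of_antitone {U : Matrix (Fin n) (Fin n) ℝ}
    (hU : U ∈ Matrix.orthogonalGroup (Fin n) ℝ) {y : EuclideanSpace ℝ (Fin n)}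
    (hy : Antitone fun i => y i) : spec (conjDiag U y) = y := by
  set Y := conjDiag U y with hY
  have h1 : Y.toMatrix.charpoly.roots = Multiset.map (fun i => y i) Finset.univ.val := by
    have : Y.toMatrix.charpoly = (Matrix.diagonal fun i => y i).charpoly := by
      rw [hY, toMatrix_conjDiag, Matrix.charpoly_mul_comm, ← Matrix.mul_assoc,
        mul_transpose_self_of_orthogonal hU, Matrix.one_mul]
    rw [this, Matrix.charpoly_diagonal]
    have h := Polynomial.roots_multiset_prod_X_sub_C (Multiset.map (fun i => y i) Finset.univ.val)
    rwa [Multiset.map_map] at h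
  have h2 : Y.toMatrix.charpoly.roots = Multiset.map (fun i => spec Y i) Finset.univ.val := by
    rw [Y.isHermitian.roots_charpoly_eq_eigenvalues₀]
    have h3 : (Finset.univ : Finset (Fin (Fintype.card (Fin n)))).val =
        Multiset.map (Fin.cast (Fintype.card_fin n).symm) (Finset.univ : Finset (Fin n)).val := by
      have := congrArg Finset.val
        (Finset.map_univ_equiv (finCongr (Fintype.card_fin n).symm))
      rw [← this]
      rfl
    rw [h3, Multiset.map_map]
    rfl
  have h4 : (List.ofFn fun i => spec Y i).Perm (List.ofFn fun i => y i) := by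
    rw [← Multiset.coe_eq_coe]
    have h := h2.symm.trans h1
    simpa only [Fin.univ_val_map] using h
  have h5 := List.ofFn_injective (h4.eq_of_pairwise' (antitone_spec Y).sortedGE_ofFn.pairwise
    hy.sortedGE_ofFn.pairwise)
  ext i
  exact congrFun h5 i

theorem spec_conjDiag {U : Matrix (Fin n) (Fin n) ℝ}
    (hU : U ∈ Matrix.orthogonalGroup (Fin n) ℝ) {x : EuclideanSpace ℝ (Fin n)}
    {σ : Equiv.Perm (Fin n)} (hσ : Antitone fun i => permute σ x i) :
    spec (conjDiag U x) = permute σ x := by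
  rw [← conjDiag_submatrix U σ x,
    spec_conjDiag_of_antitone (submatrix_mem_orthogonalGroup hU σ) hσ]

/-- Close to an ordered vector `x₀`, every vector is ordered by a permutation fixing `x₀`: strict
inequalities between coordinates persist. -/
theorem eventually_exists_antitone_permute {x₀ : EuclideanSpace ℝ (Fin n)}
    (h₀ : Antitone fun i => x₀ i) :
    ∀ᶠ x in 𝓝 x₀, ∃ σ : Equiv.Perm (Fin n), permute σ x₀ = x₀ ∧
      Antitone fun i => permute σ x i := by
  have h : ∀ᶠ x : EuclideanSpace ℝ (Fin n) in 𝓝 x₀, ∀ i j, x₀ i < x₀ j → x i < x j := by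
    refine Filter.eventually_all.2 fun i => Filter.eventually_all.2 fun j => ?_
    by_cases hij : x₀ i < x₀ j
    · have hi : Continuous fun x : EuclideanSpace ℝ (Fin n) => x i := by fun_prop
      have hj : Continuous fun x : EuclideanSpace ℝ (Fin n) => x j := by fun_prop
      filter_upwards [hi.continuousAt.eventually_lt hj.continuousAt hij] with x hx _ using hx
    · simp [hij]
  filter_upwards [h] with x hx
  obtain ⟨σ, hσ⟩ := exists_antitone_permute x
  refine ⟨σ, ?_, hσ⟩
  have h1 : Antitone ((fun i => x₀ i) ∘ σ.symm) := fun i j hij => by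
    by_contra! hlt
    exact (hx _ _ hlt).not_ge (hσ hij)
  have h2 := Tuple.unique_antitone (σ := σ.symm) (τ := 1) h1 h₀
  ext i
  exact congrFun h2 i

/-! ### Symmetric matrices and their diagonalizations -/

theorem isClosed_orthDiag (X : SymMat n) : IsClosed (orthDiag X) := by
  have h : orthDiag X = {U : Matrix (Fin n) (Fin n) ℝ | U * Uᵀ = 1} ∩
      {U | Uᵀ * Matrix.diagonal (fun i => spec X i) * U = X.toMatrix} := by
    ext U
    exact ⟨fun h => ⟨mul_transpose_self_of_orthogonal h.1, (congrArg SymMat.toMatrix h.2).symm⟩,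
      fun h => ⟨mem_orthogonalGroup_of_mul_transpose h.1, SymMat.ext h.2.symm⟩⟩
  rw [h]
  have hid : Continuous fun U : Matrix (Fin n) (Fin n) ℝ => U := continuous_id
  exact (isClosed_eq (hid.matrix_mul hid.matrix_transpose) continuous_const).inter
    (isClosed_eq ((hid.matrix_transpose.matrix_mul continuous_const).matrix_mul hid)
      continuous_const)

theorem isCompact_orthDiag (X : SymMat n) : IsCompact (orthDiag X) := by
  have h : IsCompact (Set.univ.pi fun _ => Set.univ.pi fun _ => Set.Icc (-1 : ℝ) 1 :
      Set (Matrix (Fin n) (Fin n) ℝ)) :=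
    isCompact_univ_pi fun _ => isCompact_univ_pi fun _ => isCompact_Icc
  refine h.of_isClosed_subset (isClosed_orthDiag X) fun U hU i _ j _ => ?_
  have := entry_norm_bound_of_unitary hU.1 i j
  rwa [Real.norm_eq_abs, abs_le] at this

/-- Simultaneous diagonalization with the eigenvalues of `X` in order. The symmetric operator `V`
preserves the eigenspaces of `X`, and its eigenvectors in each of them form a common orthonormal
eigenbasis. -/
theorem exists_mem_orthDiag_of_commute {X V : SymMat n}
    (h : X.toMatrix * V.toMatrix = V.toMatrix * X.toMatrix) :
    ∃ U ∈ orthDiag X, ∃ v, V = conjDiag U v := by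
  classical
  set T := Matrix.toEuclideanLin X.toMatrix with hTdef
  set S := Matrix.toEuclideanLin V.toMatrix with hSdef
  have hT : T.IsSymmetric := Matrix.isSymmetric_toEuclideanLin_iff.2 X.isHermitian
  have hS : S.IsSymmetric := Matrix.isSymmetric_toEuclideanLin_iff.2 V.isHermitian
  have hTS : ∀ z, T (S z) = S (T z) := fun z => by
    simp only [hTdef, hSdef, Matrix.toLpLin_apply, Matrix.mulVec_mulVec, h]
  have hinv : ∀ μ : Module.End.Eigenvalues T, ∀ z ∈ Module.End.eigenspace T (μ : ℝ),
      S z ∈ Module.End.eigenspace T (μ : ℝ) := fun μ z hz => by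
    rw [Module.End.mem_eigenspace_iff] at hz ⊢
    rw [hTS, hz, map_smul]
  let vf := fun μ : Module.End.Eigenvalues T =>
    (hS.restrict_invariant (hinv μ)).eigenvectorBasis rfl
  let b := hT.direct_sum_isInternal.collectedOrthonormalBasis hT.orthogonalFamily_eigenspaces' vf
  have hb : ∀ i, b i = (vf i.1 i.2 : EuclideanSpace ℝ (Fin n)) := fun i => by
    simp [b, DirectSum.IsInternal.collectedOrthonormalBasis]
  have hbT : ∀ i, ∃ μ : ℝ, T (b i) = μ • b i := fun i =>
    ⟨i.1, Module.End.mem_eigenspace_iff.1 (hb i ▸ (vf i.1 i.2).2)⟩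
  have hbS : ∀ i, ∃ ν : ℝ, S (b i) = ν • b i := fun i => by
    refine ⟨(hS.restrict_invariant (hinv i.1)).eigenvalues rfl i.2, ?_⟩
    have := (hS.restrict_invariant (hinv i.1)).apply_eigenvectorBasis rfl i.2
    rw [hb]
    exact congrArg Subtype.val this
  let e := Fintype.equivFinOfCardEq ((Module.finrank_eq_card_basis b.toBasis).symm.trans
    finrank_euclideanSpace_fin)
  let c := b.reindex e
  choose μ hμ using hbT
  choose ν hν using hbS
  have hrepr : ∀ (Z : SymMat n) (ξ : Fin n → ℝ),
      (∀ i, Matrix.toEuclideanLin Z.toMatrix (c i) = ξ i • c i) →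
      Z = conjDiag (Matrix.of fun i => ⇑(c i)) (WithLp.toLp 2 ξ) ∧
        (Matrix.of fun i => ⇑(c i)) ∈ Matrix.orthogonalGroup (Fin n) ℝ := by
    intro Z ξ hZ
    set U : Matrix (Fin n) (Fin n) ℝ := Matrix.of fun i => ⇑(c i) with hU
    have hUU : U * Uᵀ = 1 := by
      ext i j
      have := orthonormal_iff_ite.1 c.orthonormal j i
      simp only [Matrix.mul_apply, hU, Matrix.transpose_apply, Matrix.of_apply, Matrix.one_apply]
      simpa [PiLp.inner_apply, eq_comm] using this
    have hUU' : Uᵀ * U = 1 := mul_eq_one_comm.1 hUU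
    refine ⟨SymMat.ext ?_, mem_orthogonalGroup_of_mul_transpose hUU⟩
    have h1 : Z.toMatrix * Uᵀ = Uᵀ * Matrix.diagonal ξ := by
      ext a i
      have := congrArg (fun z : EuclideanSpace ℝ (Fin n) => z a) (hZ i)
      simp only [Matrix.toLpLin_apply, PiLp.smul_apply, smul_eq_mul] at this
      rw [Matrix.mul_diagonal, Matrix.transpose_apply, mul_comm]
      exact this
    calc Z.toMatrix = Z.toMatrix * (Uᵀ * U) := by rw [hUU', Matrix.mul_one]
      _ = _ := by rw [← Matrix.mul_assoc, h1]; rfl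
  obtain ⟨hX, hU⟩ := hrepr X (fun i => μ (e.symm i)) fun i => by
    simpa [c] using hμ (e.symm i)
  obtain ⟨hV, -⟩ := hrepr V (fun i => ν (e.symm i)) fun i => by
    simpa [c] using hν (e.symm i)
  set U : Matrix (Fin n) (Fin n) ℝ := Matrix.of fun i => ⇑(c i)
  obtain ⟨σ, hσ⟩ := exists_antitone_permute (WithLp.toLp 2 fun i => μ (e.symm i))
  refine ⟨U.submatrix σ.symm id, ⟨submatrix_mem_orthogonalGroup hU σ, ?_⟩,
    permute σ (WithLp.toLp 2 fun i => ν (e.symm i)), ?_⟩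
  · have := spec_conjDiag hU hσ
    rw [← hX] at this
    rw [this, conjDiag_submatrix]
    exact hX
  · rw [conjDiag_submatrix]
    exact hV

theorem orthDiag_nonempty (X : SymMat n) : (orthDiag X).Nonempty :=
  let ⟨U, hU, _⟩ := exists_mem_orthDiag_of_commute (X := X) (V := X) rfl
  ⟨U, hU⟩

theorem commute_of_mem_orthDiag {X : SymMat n} {U : Matrix (Fin n) (Fin n) ℝ}
    (hU : U ∈ orthDiag X) (v : EuclideanSpace ℝ (Fin n)) :
    X.toMatrix * (conjDiag U v).toMatrix = (conjDiag U v).toMatrix * X.toMatrix := by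
  have key : ∀ x y : EuclideanSpace ℝ (Fin n), (conjDiag U x).toMatrix * (conjDiag U y).toMatrix =
      Uᵀ * Matrix.diagonal (fun i => x i * y i) * U := fun x y => by
    calc _ = Uᵀ * Matrix.diagonal (fun i => x i) * (U * Uᵀ) *
          Matrix.diagonal (fun i => y i) * U := by
          simp only [toMatrix_conjDiag, Matrix.mul_assoc]
      _ = _ := by
          rw [mul_transpose_self_of_orthogonal hU.1, Matrix.mul_one, Matrix.mul_assoc Uᵀ,
            Matrix.diagonal_mul_diagonal]
  have hX := congrArg SymMat.toMatrix hU.2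
  rw [hX, key, key]
  simp only [mul_comm]

/-! ### Diagonals of conjugated diagonal matrices -/

/-- A local form of Schur's theorem. If `U` and `V` diagonalize the same matrix with eigenvalue
vector `x₀`, then the diagonal of `V (Uᵀ (Diag v) U) Vᵀ` is a convex combination of the images of
`v` under the permutations fixing `x₀`. The weights come from Birkhoff's theorem applied to the squared
entries of `V Uᵀ`, which vanish at `(i, j)` unless `x₀ i = x₀ j`. -/
theorem diagPart_conjDiag_mem {C : Set (EuclideanSpace ℝ (Fin n))} (hC : Convex ℝ C)
    {x₀ v : EuclideanSpace ℝ (Fin n)} {U V : Matrix (Fin n) (Fin n) ℝ}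
    (hU : U ∈ Matrix.orthogonalGroup (Fin n) ℝ) (hV : V ∈ Matrix.orthogonalGroup (Fin n) ℝ)
    (hUV : conjDiag U x₀ = conjDiag V x₀)
    (hv : ∀ σ : Equiv.Perm (Fin n), permute σ x₀ = x₀ → permute σ v ∈ C) :
    diagPart V (conjDiag U v) ∈ C := by
  have hUt := mul_transpose_self_of_orthogonal hU
  have hUt' := transpose_mul_self_of_orthogonal hU
  have hVt := mul_transpose_self_of_orthogonal hV
  set P := V * Uᵀ with hP
  have hPP : P * Pᵀ = 1 := by
    rw [hP, Matrix.transpose_mul, Matrix.transpose_transpose, Matrix.mul_assoc,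
      ← Matrix.mul_assoc Uᵀ, hUt', Matrix.one_mul, hVt]
  have hPP' : Pᵀ * P = 1 := mul_eq_one_comm.1 hPP
  have hcomm : ∀ i j, P i j ≠ 0 → x₀ i = x₀ j := by
    have h1 : P * Matrix.diagonal (fun i => x₀ i) = Matrix.diagonal (fun i => x₀ i) * P := by
      have h2 := congrArg (fun Z : SymMat n => V * Z.toMatrix * Uᵀ) hUV
      simp only [toMatrix_conjDiag] at h2
      calc P * Matrix.diagonal (fun i => x₀ i)
          = V * (Uᵀ * Matrix.diagonal (fun i => x₀ i) * U) * Uᵀ := by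
            simp only [hP, Matrix.mul_assoc, hUt, Matrix.mul_one]
        _ = (V * Vᵀ) * Matrix.diagonal (fun i => x₀ i) * (V * Uᵀ) := by
            rw [h2]; simp only [Matrix.mul_assoc]
        _ = _ := by rw [hVt, Matrix.one_mul]
    intro i j hij
    have h2 := congrFun (congrFun h1 i) j
    rw [Matrix.mul_diagonal, Matrix.diagonal_mul, mul_comm] at h2
    exact (mul_right_cancel₀ hij h2).symm
  have hS : (Matrix.of fun i j => P i j ^ 2) ∈ doublyStochastic ℝ (Fin n) := by
    refine mem_doublyStochastic_iff_sum.2 ⟨fun i j => sq_nonneg _, fun i => ?_, fun j => ?_⟩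
    · simpa [Matrix.mul_apply, sq] using congrFun (congrFun hPP i) i
    · simpa [Matrix.mul_apply, sq] using congrFun (congrFun hPP' j) j
  obtain ⟨w, hw0, hw1, hw⟩ := exists_eq_sum_perm_of_mem_doublyStochastic hS
  have hw' : ∀ i j, ∑ σ : Equiv.Perm (Fin n), w σ * (if σ i = j then 1 else 0) = P i j ^ 2 := by
    intro i j
    have := congrFun (congrFun hw i) j
    simpa [Matrix.sum_apply, Equiv.Perm.permMatrix, Equiv.toPEquiv_apply, PEquiv.toMatrix_apply,
      eq_comm] using this
  have hfix : ∀ σ, w σ ≠ 0 → permute σ.symm x₀ = x₀ := by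
    intro σ hσ
    ext i
    have h1 : w σ ≤ P i (σ i) ^ 2 := by
      rw [← hw' i (σ i)]
      refine le_trans (by simp) (Finset.single_le_sum (f := fun τ : Equiv.Perm (Fin n) =>
        w τ * (if τ i = σ i then 1 else 0)) (fun τ _ => ?_) (Finset.mem_univ σ))
      have := hw0 τ
      positivity
    have h2 : P i (σ i) ≠ 0 := fun h0 => by
      rw [h0] at h1
      exact hσ (le_antisymm (by simpa using h1) (hw0 σ))
    simpa using (hcomm _ _ h2).symm
  -- The terms of weight zero are replaced by `v`, so that every term lies in `C`.
  have hsum : diagPart V (conjDiag U v) = ∑ σ : Equiv.Perm (Fin n), w σ •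
      (if w σ = 0 then v else permute σ.symm v) := by
    ext i
    have h1 : V * (conjDiag U v).toMatrix * Vᵀ = P * Matrix.diagonal (fun i => v i) * Pᵀ := by
      simp only [toMatrix_conjDiag, hP, Matrix.transpose_mul, Matrix.transpose_transpose,
        Matrix.mul_assoc]
    have h2 : diagPart V (conjDiag U v) i = ∑ j, P i j ^ 2 * v j := by
      change (V * (conjDiag U v).toMatrix * Vᵀ) i i = _
      rw [h1, Matrix.mul_apply]
      refine Finset.sum_congr rfl fun j _ => ?_
      rw [Matrix.mul_diagonal, Matrix.transpose_apply]
      ring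
    rw [h2]
    simp only [← hw', Finset.sum_mul]
    rw [Finset.sum_comm]
    rw [WithLp.ofLp_sum, Finset.sum_apply]
    refine Finset.sum_congr rfl fun σ _ => ?_
    by_cases h0 : w σ = 0
    · simp [h0]
    · simp [h0]
  rw [hsum]
  refine hC.sum_mem (fun σ _ => hw0 σ) hw1 fun σ _ => ?_
  split_ifs with h0
  · exact hv 1 rfl
  · exact hv _ (hfix σ h0)

/-! ### Fan's trace inequality -/

/-- Fan's trace inequality. -/
theorem inner_le_inner_spec (A B : SymMat n) : ⟪A, B⟫_ℝ ≤ ⟪spec A, spec B⟫_ℝ := by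
  obtain ⟨U, hU, hA⟩ := orthDiag_nonempty A
  obtain ⟨V, hV, hB⟩ := orthDiag_nonempty B
  -- With `x₀ = 0` every permutation is admissible in the local form of Schur's theorem, which
  -- reduces the claim to the rearrangement inequality.
  have h0 : conjDiag V 0 = conjDiag U 0 :=
    ((conjDiagₗ V).map_zero).trans (conjDiagₗ U).map_zero.symm
  have hC : Convex ℝ {z : EuclideanSpace ℝ (Fin n) | ⟪spec A, z⟫_ℝ ≤ ⟪spec A, spec B⟫_ℝ} :=
    convex_halfSpace_le (innerSL ℝ (spec A)).toLinearMap.isLinear _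
  have := diagPart_conjDiag_mem hC (x₀ := 0) (v := spec B) hV hU h0 fun σ _ => by
    have hmono : Monovary (fun i => spec B i) (fun i => spec A i) :=
      (antitone_spec B).monovary (antitone_spec A)
    have := hmono.sum_comp_perm_mul_le_sum_mul (σ := σ.symm)
    simpa [PiLp.inner_apply] using this
  calc ⟪A, B⟫_ℝ = ⟪conjDiag U (spec A), conjDiag V (spec B)⟫_ℝ := by rw [← hA, ← hB]
    _ = ⟪spec A, diagPart U (conjDiag V (spec B))⟫_ℝ := inner_conjDiag_left _ _ _
    _ ≤ _ := this

theorem norm_spec (A : SymMat n) : ‖spec A‖ = ‖A‖ := by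
  obtain ⟨U, hU, hA⟩ := orthDiag_nonempty A
  conv_rhs => rw [hA, norm_conjDiag hU]

/-- The spectral map is `1`-Lipschitz. -/
theorem norm_spec_sub_le (A B : SymMat n) : ‖spec A - spec B‖ ≤ ‖A - B‖ := by
  refine le_of_sq_le_sq ?_ (norm_nonneg _)
  -- As `spec` preserves norms, this is Fan's inequality in squared form.
  rw [@norm_sub_sq_real, @norm_sub_sq_real _ _ _ A B, norm_spec, norm_spec]
  linarith [inner_le_inner_spec A B]

theorem continuous_spec : Continuous (spec : SymMat n → _) :=
  (LipschitzWith.of_dist_le_mul (K := 1) fun A B => by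
    simpa [dist_eq_norm] using norm_spec_sub_le A B).continuous

/-! ### The Fréchet subdifferential of a spectral function -/

theorem convex_frechetSubdiff {E : Type*} [NormedAddCommGroup E] [InnerProductSpace ℝ E]
    (f : E → EReal) (x₀ : E) : Convex ℝ (frechetSubdiff f x₀) := by
  rintro v ⟨hb, ht, hv⟩ w ⟨-, -, hw⟩ a b ha hab hsum
  refine ⟨hb, ht, fun ε hε => ?_⟩
  filter_upwards [hv ε hε, hw ε hε] with x h1 h2
  obtain rfl : b = 1 - a := by linarith
  rcases le_total ⟪v, x - x₀⟫_ℝ ⟪w, x - x₀⟫_ℝ with h | h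
  · refine le_trans (add_le_add_right (EReal.coe_le_coe ?_) _) h2
    rw [inner_add_left, real_inner_smul_left, real_inner_smul_left]
    nlinarith [mul_nonneg ha (sub_nonneg.2 h)]
  · refine le_trans (add_le_add_right (EReal.coe_le_coe ?_) _) h1
    rw [inner_add_left, real_inner_smul_left, real_inner_smul_left]
    nlinarith [mul_nonneg hab (sub_nonneg.2 h)]

theorem permute_mem_frechetSubdiff {f : EuclideanSpace ℝ (Fin n) → EReal}
    {x₀ v : EuclideanSpace ℝ (Fin n)} (hf : LocallySymmetricAt f x₀)
    (hv : v ∈ frechetSubdiff f x₀) {σ : Equiv.Perm (Fin n)} (hσ : permute σ x₀ = x₀) :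
    permute σ v ∈ frechetSubdiff f x₀ := by
  obtain ⟨hb, ht, hv⟩ := hv
  refine ⟨hb, ht, fun ε hε => ?_⟩
  have hlim : Filter.Tendsto (permute σ.symm) (𝓝 x₀) (𝓝 x₀) := by
    have := (continuous_permute σ.symm).tendsto x₀
    rwa [permute_symm_eq_self hσ] at this
  filter_upwards [hlim.eventually (hv ε hε), hlim.eventually hf] with x h1 h2
  rw [h2 σ hσ, permute_permute_symm] at h1
  have h3 : permute σ.symm x - x₀ = permute σ.symm (x - x₀) := by
    rw [permute_sub, permute_symm_eq_self hσ]
  rw [h3, norm_permute, ← inner_permute_permute σ, permute_permute_symm] at h1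
  exact h1

theorem nonpos_of_coe_add_le {a : EReal} (hb : a ≠ ⊥) (ht : a ≠ ⊤) {r : ℝ}
    (h : a + (r : EReal) ≤ a) : r ≤ 0 := by
  lift a to ℝ using ⟨ht, hb⟩
  rw [← EReal.coe_add, EReal.coe_le_coe_iff] at h
  linarith

/-- A Fréchet subgradient is nonpositive on the velocity of any curve along which `f` is
constant. -/
theorem inner_nonpos_of_hasDerivAt {E : Type*} [NormedAddCommGroup E] [InnerProductSpace ℝ E]
    {f : E → EReal} {γ : ℝ → E} {γ' v : E} (hγ : HasDerivAt γ γ' 0)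
    (hv : v ∈ frechetSubdiff f (γ 0)) (hf : ∀ t, f (γ t) = f (γ 0)) : ⟪v, γ'⟫_ℝ ≤ 0 := by
  obtain ⟨hb, ht, hv⟩ := hv
  have hslope := hγ.tendsto_slope_zero_right
  simp only [zero_add] at hslope
  have key : ∀ ε : ℝ, 0 < ε → ⟪v, γ'⟫_ℝ ≤ ε * ‖γ'‖ := fun ε hε => by
    refine le_of_tendsto_of_tendsto (tendsto_const_nhds.inner hslope)
      (tendsto_const_nhds.mul hslope.norm) ?_
    have h1 : ∀ᶠ t in 𝓝[>] (0 : ℝ), f (γ 0) +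
        ((⟪v, γ t - γ 0⟫_ℝ - ε * ‖γ t - γ 0‖ : ℝ) : EReal) ≤ f (γ t) :=
      (hγ.continuousAt.tendsto.mono_left nhdsWithin_le_nhds).eventually (hv ε hε)
    filter_upwards [h1, self_mem_nhdsWithin] with t h2 (h3 : 0 < t)
    rw [hf t] at h2
    have h4 := nonpos_of_coe_add_le hb ht h2
    rw [real_inner_smul_right, norm_smul, Real.norm_of_nonneg (inv_nonneg.2 h3.le)]
    have h5 := mul_le_mul_of_nonneg_left (sub_nonpos.1 h4) (inv_nonneg.2 h3.le)
    linarith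
  have hlim : Filter.Tendsto (fun ε : ℝ => ε * ‖γ'‖) (𝓝[>] 0) (𝓝 0) := by
    have : Filter.Tendsto (fun ε : ℝ => ε * ‖γ'‖) (𝓝 0) (𝓝 (0 * ‖γ'‖)) :=
      (continuous_id.mul continuous_const).tendsto 0
    rw [zero_mul] at this
    exact this.mono_left nhdsWithin_le_nhds
  refine ge_of_tendsto hlim ?_
  filter_upwards [self_mem_nhdsWithin] with ε hε using key ε hε

/-- The symmetrization of a matrix. -/
def symmetrize (n : ℕ) : Matrix (Fin n) (Fin n) ℝ →ₗ[ℝ] SymMat n where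
  toFun M := ⟨(1 / 2 : ℝ) • (M + Mᵀ), by
    change ((1 / 2 : ℝ) • (M + Mᵀ))ᵀ = _
    rw [Matrix.transpose_smul, Matrix.transpose_add, Matrix.transpose_transpose, add_comm]⟩
  map_add' M N := SymMat.ext <| by
    change (1 / 2 : ℝ) • (M + N + (M + N)ᵀ) = (1 / 2 : ℝ) • (M + Mᵀ) + (1 / 2 : ℝ) • (N + Nᵀ)
    rw [Matrix.transpose_add, ← smul_add]
    congr 1
    abel
  map_smul' c M := SymMat.ext <| by
    change (1 / 2 : ℝ) • (c • M + (c • M)ᵀ) = c • (1 / 2 : ℝ) • (M + Mᵀ)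
    rw [Matrix.transpose_smul, ← smul_add, smul_comm]

theorem symmetrize_toMatrix (X : SymMat n) : symmetrize n X.toMatrix = X := SymMat.ext <| by
  change (1 / 2 : ℝ) • (X.toMatrix + X.toMatrixᵀ) = X.toMatrix
  rw [X.isSymm.eq, ← two_smul ℝ X.toMatrix, smul_smul]
  norm_num

section Exponential

open NormedSpace

-- A normed algebra structure is needed only to differentiate the exponential; its topology is the
-- entrywise one.
attribute [local instance] Matrix.linftyOpNormedRing Matrix.linftyOpNormedAlgebra

theorem exp_smul_mem_orthogonalGroup {A : Matrix (Fin n) (Fin n) ℝ} (hA : Aᵀ = -A) (t : ℝ) :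
    exp (t • A) ∈ Matrix.orthogonalGroup (Fin n) ℝ := by
  refine mem_orthogonalGroup_of_mul_transpose ?_
  have hc : Commute (t • A) (-(t • A)) := (Commute.refl (t • A)).neg_right
  rw [← Matrix.exp_transpose, Matrix.transpose_smul, hA, smul_neg,
    ← Matrix.exp_add_of_commute _ _ hc, add_neg_cancel, exp_zero]

/-- The velocity of the orbit `t ↦ exp(tA)ᵀ X exp(tA)`, for skew-symmetric `A`, is `XA - AX`. -/
theorem hasDerivAt_orbit {A : Matrix (Fin n) (Fin n) ℝ} (hA : Aᵀ = -A)
    (X : Matrix (Fin n) (Fin n) ℝ) :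
    HasDerivAt (fun t : ℝ => (exp (t • A))ᵀ * X * exp (t • A)) (X * A - A * X) 0 := by
  have h1 : HasDerivAt (fun t : ℝ => exp (t • A)) A 0 := by
    have h := hasDerivAt_exp_smul_const (𝕂 := ℝ) A 0
    rw [zero_smul, exp_zero, one_mul] at h
    exact h
  have h2 : HasDerivAt (fun t : ℝ => exp (t • (-A))) (-A) 0 := by
    have h := hasDerivAt_exp_smul_const (𝕂 := ℝ) (-A) 0
    rw [zero_smul, exp_zero, one_mul] at h
    exact h
  have h3 : (fun t : ℝ => (exp (t • A))ᵀ * X * exp (t • A)) =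
      fun t : ℝ => exp (t • (-A)) * X * exp (t • A) := by
    funext t
    rw [← Matrix.exp_transpose, Matrix.transpose_smul, hA]
  rw [h3]
  have h4 := (h2.mul_const X).mul h1
  have h5 : -A * X * exp ((0 : ℝ) • A) + exp ((0 : ℝ) • (-A)) * X * A = X * A - A * X := by
    rw [zero_smul, zero_smul, exp_zero, Matrix.one_mul, Matrix.mul_one, Matrix.neg_mul,
      sub_eq_add_neg, add_comm]
  rw [← h5]
  exact h4

/-- A subgradient `V` of a spectral function at `X` commutes with `X`: the function is constant
along the orbit of `X` under orthogonal conjugation, and the commutator `XV - VX` generates a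
direction of that orbit along which `V` would otherwise be positive. -/
theorem commute_of_mem_frechetSubdiff {f : EuclideanSpace ℝ (Fin n) → EReal} {X V : SymMat n}
    (hV : V ∈ frechetSubdiff (f ∘ spec) X) :
    X.toMatrix * V.toMatrix = V.toMatrix * X.toMatrix := by
  obtain ⟨U, hU⟩ := orthDiag_nonempty X
  obtain ⟨A, hAdef⟩ : ∃ A, A = X.toMatrix * V.toMatrix - V.toMatrix * X.toMatrix := ⟨_, rfl⟩
  have hA : Aᵀ = -A := by
    rw [hAdef, Matrix.transpose_sub, Matrix.transpose_mul, Matrix.transpose_mul, X.isSymm.eq,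
      V.isSymm.eq, neg_sub]
  let γ : ℝ → SymMat n := fun t => conjDiag (U * exp (t • A)) (spec X)
  have hγm : ∀ t, (γ t).toMatrix = (exp (t • A))ᵀ * X.toMatrix * exp (t • A) := fun t => by
    have hX : X.toMatrix = Uᵀ * Matrix.diagonal (fun i => spec X i) * U :=
      congrArg SymMat.toMatrix hU.2
    rw [toMatrix_conjDiag, Matrix.transpose_mul]
    conv_rhs => rw [hX]
    simp only [Matrix.mul_assoc]
  have hγ0 : γ 0 = X := SymMat.ext <| by simp [hγm]
  have hspec : ∀ t, spec (γ t) = spec X := fun t =>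
    spec_conjDiag_of_antitone (mul_mem hU.1 (exp_smul_mem_orthogonalGroup hA t)) (antitone_spec X)
  have hγ : HasDerivAt γ (symmetrize n (X.toMatrix * A - A * X.toMatrix)) 0 := by
    have h := (LinearMap.toContinuousLinearMap (symmetrize n)).hasFDerivAt.comp_hasDerivAt
      (0 : ℝ) (hasDerivAt_orbit hA X.toMatrix)
    have hγ' : γ = fun t => symmetrize n ((exp (t • A))ᵀ * X.toMatrix * exp (t • A)) := by
      funext t
      rw [← hγm, symmetrize_toMatrix]
    rw [hγ']
    exact h
  have hle := inner_nonpos_of_hasDerivAt hγ (f := f ∘ spec) (v := V) (by rwa [hγ0]) fun t => by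
    simp only [Function.comp_apply, hspec]
  have hsymm : (X.toMatrix * A - A * X.toMatrix)ᵀ = X.toMatrix * A - A * X.toMatrix := by
    rw [Matrix.transpose_sub, Matrix.transpose_mul, Matrix.transpose_mul, hA, X.isSymm.eq]
    simp only [Matrix.neg_mul, Matrix.mul_neg]
    abel
  have hval : (symmetrize n (X.toMatrix * A - A * X.toMatrix)).toMatrix =
      X.toMatrix * A - A * X.toMatrix :=
    congrArg SymMat.toMatrix (symmetrize_toMatrix
      (⟨X.toMatrix * A - A * X.toMatrix, hsymm⟩ : SymMat n))
  have htr : ⟪V, symmetrize n (X.toMatrix * A - A * X.toMatrix)⟫_ℝ = (Aᵀ * A).trace := by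
    have hA' : Aᵀ = V.toMatrix * X.toMatrix - X.toMatrix * V.toMatrix := by
      rw [hA, hAdef, neg_sub]
    rw [SymMat.inner_eq_trace, hval, hA', Matrix.mul_sub, Matrix.sub_mul, Matrix.trace_sub,
      Matrix.trace_sub, ← Matrix.mul_assoc V.toMatrix A,
      Matrix.trace_mul_comm (V.toMatrix * A), ← Matrix.mul_assoc, ← Matrix.mul_assoc]
  have hzero : (Aᵀ * A).trace = 0 := by
    refine le_antisymm (htr ▸ hle) ?_
    have := (Matrix.posSemidef_conjTranspose_mul_self A).trace_nonneg
    rwa [Matrix.conjTranspose_eq_transpose_of_trivial] at this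
  rw [← Matrix.conjTranspose_eq_transpose_of_trivial,
    Matrix.trace_conjTranspose_mul_self_eq_zero_iff] at hzero
  exact sub_eq_zero.1 (hAdef.symm.trans hzero)

end Exponential

/-- Restricting to the matrices `Uᵀ (Diag x) U` turns a subgradient of `f ∘ λ` into one of `f`: near
`λ(X)` the map `λ` only rearranges `x` by a permutation fixing `λ(X)`, which does not change
`f x`. -/
theorem mem_frechetSubdiff_of_conjDiag_mem {f : EuclideanSpace ℝ (Fin n) → EReal} {X : SymMat n}
    (hf : LocallySymmetricAt f (spec X)) {U : Matrix (Fin n) (Fin n) ℝ} (hU : U ∈ orthDiag X)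
    {v : EuclideanSpace ℝ (Fin n)} (hv : conjDiag U v ∈ frechetSubdiff (f ∘ spec) X) :
    v ∈ frechetSubdiff f (spec X) := by
  obtain ⟨hb, ht, hv⟩ := hv
  refine ⟨hb, ht, fun ε hε => ?_⟩
  have hlim : Filter.Tendsto (conjDiag U) (𝓝 (spec X)) (𝓝 X) := by
    have := (continuous_conjDiag U).tendsto (spec X)
    rwa [← hU.2] at this
  filter_upwards [hlim.eventually (hv ε hε), hf,
    eventually_exists_antitone_permute (antitone_spec X)] with x h1 h2 ⟨σ, hσ, hanti⟩
  have h3 : conjDiag U x - X = conjDiag U (x - spec X) := by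
    rw [conjDiag_sub, ← hU.2]
  rwa [h3, inner_conjDiag_conjDiag hU.1, norm_conjDiag hU.1, Function.comp_apply,
    Function.comp_apply, spec_conjDiag hU.1 hanti, ← h2 σ hσ] at h1

/-- A first-order lower estimate of `spec Y - spec X` with quadratic error, uniform in `Y`.
Fan's inequality is applied to `X + t (Uᵀ (Diag v) U)` and `Y`, where `t` is small enough that the
eigenvalue vector of the former is `spec X + t (permute σ v)` with `σ` fixing `spec X`. -/
theorem exists_inner_le_inner_spec_sub (X : SymMat n) {U : Matrix (Fin n) (Fin n) ℝ}
    (hU : U ∈ orthDiag X) (v : EuclideanSpace ℝ (Fin n)) :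
    ∃ σ : Equiv.Perm (Fin n), permute σ (spec X) = spec X ∧ ∃ K : ℝ, 0 < K ∧ ∀ Y : SymMat n,
      ⟪conjDiag U v, Y - X⟫_ℝ ≤ ⟪permute σ v, spec Y - spec X⟫_ℝ + K * ‖Y - X‖ ^ 2 := by
  have hlim : Filter.Tendsto (fun t : ℝ => spec X + t • v) (𝓝[>] 0) (𝓝 (spec X)) := by
    have h : Continuous fun t : ℝ => spec X + t • v := by fun_prop
    have := h.tendsto 0
    rw [zero_smul, add_zero] at this
    exact this.mono_left nhdsWithin_le_nhds
  obtain ⟨t, ⟨σ, hσ, hanti⟩, ht⟩ := ((hlim.eventually (eventually_exists_antitone_permute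
    (antitone_spec X))).and self_mem_nhdsWithin).exists
  replace ht : 0 < t := ht
  have hsp := spec_conjDiag hU.1 hanti
  have hperm : permute σ (spec X + t • v) = spec X + t • permute σ v := by
    conv_rhs => rw [← hσ]
    ext i
    simp
  have hA : conjDiag U (spec X + t • v) = X + t • conjDiag U v := by
    rw [conjDiag_add, conjDiag_smul, ← hU.2]
  rw [hperm, hA] at hsp
  refine ⟨σ, hσ, 1 / (2 * t), by positivity, fun Y => ?_⟩
  have hfan := inner_le_inner_spec (X + t • conjDiag U v) Y
  rw [hsp, inner_add_left, inner_add_left, real_inner_smul_left, real_inner_smul_left] at hfan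
  have h1 : ⟪conjDiag U v, X⟫_ℝ = ⟪permute σ v, spec X⟫_ℝ := by
    conv_lhs => rw [hU.2, inner_conjDiag_conjDiag hU.1]
    rw [← inner_permute_permute σ, hσ]
  -- Since `spec` preserves norms, the left side is `(‖Y - X‖² - ‖spec Y - spec X‖²) / 2`.
  have h2 : ⟪spec X, spec Y⟫_ℝ - ⟪X, Y⟫_ℝ ≤ ‖Y - X‖ ^ 2 / 2 := by
    have h3 := @norm_sub_sq_real _ _ _ Y X
    have h4 := norm_sub_sq_real (spec Y) (spec X)
    rw [norm_spec, norm_spec] at h4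
    rw [real_inner_comm] at h3 h4
    nlinarith [sq_nonneg ‖spec Y - spec X‖]
  rw [inner_sub_right, inner_sub_right, h1]
  have h5 : t * (1 / (2 * t) * ‖Y - X‖ ^ 2) = ‖Y - X‖ ^ 2 / 2 := by
    field_simp
  refine le_of_mul_le_mul_left ?_ ht
  rw [mul_add, h5]
  linarith

theorem conjDiag_mem_frechetSubdiff {f : EuclideanSpace ℝ (Fin n) → EReal} {X : SymMat n}
    (hf : LocallySymmetricAt f (spec X)) {U : Matrix (Fin n) (Fin n) ℝ} (hU : U ∈ orthDiag X)
    {v : EuclideanSpace ℝ (Fin n)} (hv : v ∈ frechetSubdiff f (spec X)) :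
    conjDiag U v ∈ frechetSubdiff (f ∘ spec) X := by
  obtain ⟨σ, hσ, K, hK, hle⟩ := exists_inner_le_inner_spec_sub X hU v
  obtain ⟨hb, ht, hw⟩ := permute_mem_frechetSubdiff hf hv hσ
  refine ⟨hb, ht, fun ε hε => ?_⟩
  -- On this ball the quadratic error is at most `(ε / 2) ‖Y - X‖`.
  have hball : ∀ᶠ Y in 𝓝 X, ‖Y - X‖ < ε / 2 / K := by
    filter_upwards [Metric.ball_mem_nhds X (show 0 < ε / 2 / K by positivity)] with Y hY
    rwa [Metric.mem_ball, dist_eq_norm] at hY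
  filter_upwards [(continuous_spec.tendsto X).eventually (hw (ε / 2) (half_pos hε)), hball]
    with Y h1 h2
  refine le_trans (add_le_add_right (EReal.coe_le_coe ?_) _) h1
  have h3 := norm_spec_sub_le Y X
  have h4 := hle Y
  have h5 : K * ‖Y - X‖ ^ 2 ≤ ε / 2 * ‖Y - X‖ := by
    have := (lt_div_iff₀ hK).1 h2
    nlinarith [norm_nonneg (Y - X)]
  nlinarith

/-- The set of all `Uᵀ (Diag v) U` with `v ∈ C` and `U ∈ 𝐎ⁿ_X`. -/
def spectralLift (X : SymMat n) (C : Set (EuclideanSpace ℝ (Fin n))) : Set (SymMat n) :=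
  {V | ∃ v ∈ C, ∃ U ∈ orthDiag X, V = conjDiag U v}

theorem frechetSubdiff_comp_spec {f : EuclideanSpace ℝ (Fin n) → EReal} {X : SymMat n}
    (hf : LocallySymmetricAt f (spec X)) :
    frechetSubdiff (f ∘ spec) X = spectralLift X (frechetSubdiff f (spec X)) := by
  refine Set.Subset.antisymm (fun V hV => ?_) ?_
  · obtain ⟨U, hU, v, rfl⟩ := exists_mem_orthDiag_of_commute (commute_of_mem_frechetSubdiff hV)
    exact ⟨v, mem_frechetSubdiff_of_conjDiag_mem hf hU hV, U, hU, rfl⟩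
  · rintro _ ⟨v, hv, U, hU, rfl⟩
    exact conjDiag_mem_frechetSubdiff hf hU hv

/-! ### Relative interiors of convex sets -/

theorem mem_intrinsicInterior_iff_eventually {E : Type*} [NormedAddCommGroup E] [NormedSpace ℝ E]
    {s : Set E} {x : E} : x ∈ intrinsicInterior ℝ s ↔
      x ∈ affineSpan ℝ s ∧ ∀ᶠ y in 𝓝 x, y ∈ affineSpan ℝ s → y ∈ s := by
  rw [mem_intrinsicInterior]
  constructor
  · rintro ⟨y, hy, rfl⟩
    refine ⟨y.2, ?_⟩
    rw [mem_interior_iff_mem_nhds, nhds_subtype_eq_comap, Filter.mem_comap] at hy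
    obtain ⟨O, hO, hsub⟩ := hy
    filter_upwards [hO] with z hz hzs
    exact hsub (show (⟨z, hzs⟩ : affineSpan ℝ s) ∈ _ from hz)
  · rintro ⟨hx, h⟩
    refine ⟨⟨x, hx⟩, ?_, rfl⟩
    rw [mem_interior_iff_mem_nhds, nhds_subtype_eq_comap, Filter.mem_comap]
    exact ⟨_, h, fun z hz => hz z.2⟩

theorem convex_intrinsicInterior {E : Type*} [NormedAddCommGroup E] [NormedSpace ℝ E]
    {s : Set E} (hs : Convex ℝ s) : Convex ℝ (intrinsicInterior ℝ s) := by
  intro x hx y hy a b ha hb hab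
  rw [mem_intrinsicInterior_iff_eventually] at hx hy ⊢
  set z := a • x + b • y with hz
  have hzA : z ∈ affineSpan ℝ s := (affineSpan ℝ s).convex hx.1 hy.1 ha hb hab
  refine ⟨hzA, ?_⟩
  have hlim : ∀ p : E, Filter.Tendsto (fun q => (q - z) + p) (𝓝 z) (𝓝 p) := fun p => by
    have h : Continuous fun q => (q - z) + p := by fun_prop
    simpa using h.tendsto z
  -- A point `q` near `z` is the convex combination of the translates of `x` and `y` by `q - z`.
  filter_upwards [(hlim x).eventually hx.2, (hlim y).eventually hy.2] with q h1 h2 hq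
  have hdir : ∀ p ∈ affineSpan ℝ s, (q - z) + p ∈ affineSpan ℝ s := fun p hp =>
    AffineSubspace.vadd_mem_of_mem_direction (AffineSubspace.vsub_mem_direction hq hzA) hp
  have := hs (h1 (hdir x hx.1)) (h2 (hdir y hy.1)) ha hb hab
  convert this using 1
  rw [smul_add, smul_add, add_add_add_comm, ← add_smul, hab, one_smul, ← hz, sub_add_cancel]

/-! ### Affine span, closure and relative interior of spectral lifts -/

/-- `C` is invariant under the coordinate permutations that fix `x₀`. -/
def StabInvariant (x₀ : EuclideanSpace ℝ (Fin n)) (C : Set (EuclideanSpace ℝ (Fin n))) : Prop :=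
  ∀ σ : Equiv.Perm (Fin n), permute σ x₀ = x₀ → ∀ v ∈ C, permute σ v ∈ C

variable {x₀ : EuclideanSpace ℝ (Fin n)} {C : Set (EuclideanSpace ℝ (Fin n))} {X : SymMat n}

theorem StabInvariant.affineSpan (hC : StabInvariant x₀ C) :
    StabInvariant x₀ (affineSpan ℝ C : Set (EuclideanSpace ℝ (Fin n))) := by
  intro σ hσ v hv
  have h := AffineSubspace.map_span (permuteₗᵢ σ).toLinearEquiv.toLinearMap.toAffineMap C
  have hmem : permute σ v ∈
      (_root_.affineSpan ℝ C).map (permuteₗᵢ σ).toLinearEquiv.toLinearMap.toAffineMap :=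
    ⟨v, hv, permuteₗᵢ_apply σ v⟩
  rw [h] at hmem
  refine affineSpan_mono ℝ ?_ hmem
  rintro _ ⟨w, hw, rfl⟩
  exact (permuteₗᵢ_apply σ w).symm ▸ hC σ hσ w hw

theorem StabInvariant.intrinsicInterior (hC : StabInvariant x₀ C) :
    StabInvariant x₀ (intrinsicInterior ℝ C) := by
  intro σ hσ v hv
  rw [mem_intrinsicInterior_iff_eventually] at hv ⊢
  refine ⟨hC.affineSpan σ hσ v hv.1, ?_⟩
  have hlim : Filter.Tendsto (permute σ.symm) (𝓝 (permute σ v)) (𝓝 v) := by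
    have := (continuous_permute σ.symm).tendsto (permute σ v)
    rwa [permute_symm_permute] at this
  filter_upwards [hlim.eventually hv.2] with w h1 h2
  have := hC σ hσ _ (h1 (hC.affineSpan σ.symm (permute_symm_eq_self hσ) w h2))
  rwa [permute_permute_symm] at this

theorem spectralLift_mono {D : Set (EuclideanSpace ℝ (Fin n))} (h : C ⊆ D) :
    spectralLift X C ⊆ spectralLift X D := by
  rintro _ ⟨v, hv, U, hU, rfl⟩
  exact ⟨v, h hv, U, hU, rfl⟩

/-- By the local form of Schur's theorem, the eigenvalue vector of an element of a lift belongs to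
the base set in every diagonalization. -/
theorem diagPart_mem_of_mem_spectralLift (hC : Convex ℝ C) (hCs : StabInvariant (spec X) C)
    {Y : SymMat n} (hY : Y ∈ spectralLift X C) {V : Matrix (Fin n) (Fin n) ℝ}
    (hV : V ∈ orthDiag X) : diagPart V Y ∈ C := by
  obtain ⟨v, hv, U, hU, rfl⟩ := hY
  exact diagPart_conjDiag_mem hC hU.1 hV.1 (hU.2.symm.trans hV.2) fun σ hσ => hCs σ hσ v hv

theorem conjDiag_mem_spectralLift_iff (hC : Convex ℝ C) (hCs : StabInvariant (spec X) C)
    {U : Matrix (Fin n) (Fin n) ℝ} (hU : U ∈ orthDiag X) {v : EuclideanSpace ℝ (Fin n)} :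
    conjDiag U v ∈ spectralLift X C ↔ v ∈ C := by
  refine ⟨fun h => ?_, fun h => ⟨v, h, U, hU, rfl⟩⟩
  have := diagPart_mem_of_mem_spectralLift hC hCs h hU
  rwa [diagPart_conjDiag_self hU.1] at this

/-- The matrices commuting with `X`, as a subspace of `𝐒ⁿ`. -/
def commutant (X : SymMat n) : Submodule ℝ (SymMat n) where
  carrier := {Y | X.toMatrix * Y.toMatrix = Y.toMatrix * X.toMatrix}
  add_mem' {Y Z} (hY : _ = _) (hZ : _ = _) := by
    change _ = _
    rw [SymMat.toMatrix_add, Matrix.mul_add, Matrix.add_mul, hY, hZ]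
  zero_mem' := (Matrix.mul_zero _).trans (Matrix.zero_mul _).symm
  smul_mem' c Y (hY : _ = _) := by
    change _ = _
    rw [SymMat.toMatrix_smul, Matrix.mul_smul, Matrix.smul_mul, hY]

theorem spectralLift_subset_commutant : spectralLift X C ⊆ commutant X := by
  rintro _ ⟨v, -, U, hU, rfl⟩
  exact commute_of_mem_orthDiag hU v

theorem affineSpan_spectralLift (hC : Convex ℝ C) (hCs : StabInvariant (spec X) C) :
    (affineSpan ℝ (spectralLift X C) : Set (SymMat n)) = spectralLift X (affineSpan ℝ C) := by
  refine Set.Subset.antisymm (fun Y hY => ?_) ?_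
  · have hcomm : Y ∈ commutant X := by
      have hle : affineSpan ℝ (spectralLift X C) ≤ (commutant X).toAffineSubspace :=
        affineSpan_le.2 spectralLift_subset_commutant
      exact hle hY
    obtain ⟨U, hU, v, rfl⟩ := exists_mem_orthDiag_of_commute hcomm
    refine ⟨v, ?_, U, hU, rfl⟩
    have h := AffineSubspace.map_span (diagPartₗ U).toAffineMap (spectralLift X C)
    have hmem : v ∈ (affineSpan ℝ (spectralLift X C)).map (diagPartₗ U).toAffineMap :=
      ⟨_, hY, diagPart_conjDiag_self hU.1 v⟩
    rw [h] at hmem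
    refine affineSpan_mono ℝ ?_ hmem
    rintro _ ⟨Z, hZ, rfl⟩
    exact diagPart_mem_of_mem_spectralLift hC hCs hZ hU
  · rintro _ ⟨v, hv, U, hU, rfl⟩
    have h := AffineSubspace.map_span (conjDiagₗ U).toAffineMap C
    have hmem : conjDiag U v ∈ (affineSpan ℝ C).map (conjDiagₗ U).toAffineMap := ⟨v, hv, rfl⟩
    rw [h] at hmem
    refine affineSpan_mono ℝ ?_ hmem
    rintro _ ⟨w, hw, rfl⟩
    exact ⟨w, hw, U, hU, rfl⟩

theorem closure_spectralLift (hC : Convex ℝ C) (hCs : StabInvariant (spec X) C) :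
    closure (spectralLift X C) = spectralLift X (closure C) := by
  refine Set.Subset.antisymm (fun Y hY => ?_) ?_
  · have hcomm : Y ∈ commutant X :=
      closure_minimal spectralLift_subset_commutant (commutant X).closed_of_finiteDimensional hY
    obtain ⟨U, hU, v, rfl⟩ := exists_mem_orthDiag_of_commute hcomm
    refine ⟨v, ?_, U, hU, rfl⟩
    have := map_mem_closure (diagPartₗ U).continuous_of_finiteDimensional hY fun Z hZ =>
      diagPart_mem_of_mem_spectralLift hC hCs hZ hU
    rwa [diagPartₗ_apply, diagPart_conjDiag_self hU.1] at this
  · rintro _ ⟨v, hv, U, hU, rfl⟩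
    exact map_mem_closure (continuous_conjDiag U) hv fun w hw => ⟨w, hw, U, hU, rfl⟩

theorem intrinsicInterior_spectralLift (hC : Convex ℝ C) (hCs : StabInvariant (spec X) C) :
    intrinsicInterior ℝ (spectralLift X C) = spectralLift X (intrinsicInterior ℝ C) := by
  have haff := affineSpan_spectralLift hC hCs
  have haff' : ∀ Y, Y ∈ affineSpan ℝ (spectralLift X C) ↔ Y ∈ spectralLift X (affineSpan ℝ C) :=
    fun Y => Set.ext_iff.1 haff Y
  refine Set.Subset.antisymm (fun Y hY => ?_) fun Y hY => ?_
  · obtain ⟨v, hv, U, hU, rfl⟩ := intrinsicInterior_subset hY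
    refine ⟨v, ?_, U, hU, rfl⟩
    rw [mem_intrinsicInterior_iff_eventually] at hY ⊢
    refine ⟨subset_affineSpan ℝ C hv, ?_⟩
    filter_upwards [((continuous_conjDiag U).tendsto v).eventually hY.2] with w h1 h2
    exact (conjDiag_mem_spectralLift_iff hC hCs hU).1 (h1 ((haff' _).2 ⟨w, h2, U, hU, rfl⟩))
  · -- All diagonals of `Y` lie in the relative interior of `C`; by compactness of `𝐎ⁿ_X`, those of
    -- nearby matrices stay in `C` uniformly in the diagonalizing matrix.
    rw [mem_intrinsicInterior_iff_eventually]
    refine ⟨(haff' Y).2 (spectralLift_mono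
      (intrinsicInterior_subset.trans (subset_affineSpan ℝ C)) hY), ?_⟩
    have key : ∀ᶠ Z in 𝓝 Y, ∀ V ∈ orthDiag X,
        diagPart V Z ∈ affineSpan ℝ C → diagPart V Z ∈ C := by
      refine (isCompact_orthDiag X).eventually_forall_of_forall_eventually fun V hV => ?_
      have h := diagPart_mem_of_mem_spectralLift (convex_intrinsicInterior hC)
        hCs.intrinsicInterior hY hV
      exact (continuous_uncurry_diagPart.tendsto (Y, V)).eventually
        (mem_intrinsicInterior_iff_eventually.1 h).2
    filter_upwards [key] with Z h1 h2
    obtain ⟨w, hw, V, hV, rfl⟩ := (haff' Z).1 h2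
    have h3 := h1 V hV
    rw [diagPart_conjDiag_self hV.1] at h3
    exact ⟨w, h3 hw, V, hV, rfl⟩

theorem intrinsicFrontier_spectralLift (hC : Convex ℝ C) (hCs : StabInvariant (spec X) C) :
    intrinsicFrontier ℝ (spectralLift X C) = spectralLift X (intrinsicFrontier ℝ C) := by
  rw [← closure_sdiff_intrinsicInterior, ← closure_sdiff_intrinsicInterior,
    closure_spectralLift hC hCs, intrinsicInterior_spectralLift hC hCs]
  have hri : ∀ {U : Matrix (Fin n) (Fin n) ℝ}, U ∈ orthDiag X → ∀ v : EuclideanSpace ℝ (Fin n),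
      conjDiag U v ∈ spectralLift X (intrinsicInterior ℝ C) ↔ v ∈ intrinsicInterior ℝ C :=
    fun hU _ => conjDiag_mem_spectralLift_iff (convex_intrinsicInterior hC)
      hCs.intrinsicInterior hU
  ext Y
  constructor
  · rintro ⟨⟨v, hv, U, hU, rfl⟩, h⟩
    exact ⟨v, ⟨hv, fun hv' => h ((hri hU v).2 hv')⟩, U, hU, rfl⟩
  · rintro ⟨v, ⟨hv, hv'⟩, U, hU, rfl⟩
    exact ⟨⟨v, hv, U, hU, rfl⟩, fun h => hv' ((hri hU v).1 h)⟩

end SpectralSub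

end

theorem proposition3p11 (n : ℕ) (f : EuclideanSpace ℝ (Fin n) → EReal) (X : SpectralSub.SymMat n)
    (hf : SpectralSub.LocallySymmetricAt f (SpectralSub.spec X)) :
    (affineSpan ℝ (SpectralSub.frechetSubdiff (f ∘ SpectralSub.spec) X) :
        Set (SpectralSub.SymMat n)) =
      {V | ∃ v ∈ affineSpan ℝ (SpectralSub.frechetSubdiff f (SpectralSub.spec X)),
        ∃ U ∈ SpectralSub.orthDiag X, V = SpectralSub.conjDiag U v} ∧
    intrinsicFrontier ℝ (SpectralSub.frechetSubdiff (f ∘ SpectralSub.spec) X) =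
      {V | ∃ v ∈ intrinsicFrontier ℝ (SpectralSub.frechetSubdiff f (SpectralSub.spec X)),
        ∃ U ∈ SpectralSub.orthDiag X, V = SpectralSub.conjDiag U v} ∧
    intrinsicInterior ℝ (SpectralSub.frechetSubdiff (f ∘ SpectralSub.spec) X) =
      {V | ∃ v ∈ intrinsicInterior ℝ (SpectralSub.frechetSubdiff f (SpectralSub.spec X)),
        ∃ U ∈ SpectralSub.orthDiag X, V = SpectralSub.conjDiag U v} := by
  have hC := SpectralSub.convex_frechetSubdiff f (SpectralSub.spec X)
  have hCs : SpectralSub.StabInvariant (SpectralSub.spec X)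
      (SpectralSub.frechetSubdiff f (SpectralSub.spec X)) :=
    fun _ hσ _ hv => SpectralSub.permute_mem_frechetSubdiff hf hv hσ
  rw [SpectralSub.frechetSubdiff_comp_spec hf]
  exact ⟨SpectralSub.affineSpan_spectralLift hC hCs,
    SpectralSub.intrinsicFrontier_spectralLift hC hCs,
    SpectralSub.intrinsicInterior_spectralLift hC hCs⟩
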